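/- Let $X$ be a (Hausdorff, second countable, finite-dimensional) complex manifold and let $\Omega\subsetneq X$ be a domain (a non-empty connected open subset). Let $k_\Omega$ be the Kobayashi pseudodistance of $\Omega$, and assume that $\Omega$ is complete Kobayashi hyperbolic, i.e. $k_\Omega$ is a distance and $(\Omega,k_\Omega)$ is a complete metric space. *End compactification.* Fix an exhaustion of $\overline\Omega$ (closure in $X$) by compact sets $K_j\subset\operatorname{int}K_{j+1}$ (interior relative to $\overline\Omega$). An end of $\overline\Omega$ is a decreasing sequence $(F_j)$, where $F_j$ is a connected component of $\overline\Omega\setminus K_j$. Let $\overline\Omega^{\rm End}$ be the disjoint union of $\overline\Omega$ and the set of ends, topologized by taking as neighbourhoods of $y\in\overline\Omega$ its neighbourhoods in $\overline\Omega$, and as basic neighbourhoods of an end $(F_j)$ the sets $\widehat F_j$ consisting of the points of $F_j$ and the ends that agree with $(F_j)$ up to index $j$ (a set is open if it is a neighbourhood, in this sense, of each of its points). Put $\partial\overline\Omega^{\rm End}=\overline\Omega^{\rm End}\setminus\Omega$, and assume that $\overline\Omega^{\rm End}$ is sequentially compact. *Metric compactification.* Let $C_*(\Omega)$ be the quotient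 of the space $C(\Omega)$ of continuous functions $\Omega\to\mathbb R$ (topology of locally uniform convergence) by the constants, and let $i(z)=[k_\Omega(z,\cdot)]\in C_*(\Omega)$. The metric compactification $\overline\Omega^{k}$ is the closure of $i(\Omega)$ in $C_*(\Omega)$, and the points of $\overline\Omega^{k}\setminus i(\Omega)$ are the metric boundary points. For $p\in\Omega$, $R>0$, a metric boundary point $\xi$ and $x\in\partial\overline\Omega^{\rm End}$, let $h_{p,\xi}$ be the representative of $\xi$ with $h_{p,\xi}(p)=0$ and put $$H_p(\xi,R)=\{z\in\Omega: h_{p,\xi}(z)<\tfrac12\log R\},$$ $$H^b_p(x,R)=\Big\{z\in\Omega:\liminf_{\Omega\ni w\to x}\big(k_\Omega(z,w)-k_\Omega(p,w)\big)<\tfrac12\log R\Big\},$$ $$H^s_p(x,R)=\Big\{z\in\Omega:\limsup_{\Omega\ni w\to x}\big(k_\Omega(z,w)-k_\Omega(p,w)\big)<\tfrac12\log R\Big\}.$$ Let $\mathscr H(x)$ be the set of metric boundary points $\xi$ for which there is a sequence $(x_n)$ in $\Omega$ with $x_n\to x$ in $\overline\Omega^{\rm End}$ and $i(x_n)\to\xi$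 in $\overline\Omega^{k}$. **Theorem.** Suppose in addition that $$\lim_{(z,w)\to(x,y)}k_\Omega(z,w)=\infty\qquad\text{for all } x\neq y \text{ in } \partial\Omega,$$ where $\partial\Omega$ is the boundary of $\Omega$ in $X$. Let $f:\Omega\to\Omega$ be a holomorphic map whose sequence of iterates $(f^n)_{n\ge1}$ is compactly divergent (for all compact $A,B\subset\Omega$ one has $f^n(A)\cap B=\emptyset$ for all large $n$), and let $p\in\Omega$. Then there exist $x\in\partial\overline\Omega^{\rm End}$ and $\xi\in\mathscr H(x)$ such that, for every $n\in\mathbb N$ and every $R>0$, $$f^n(H_p(\xi,R))\subset H^b_p(x,R).$$ In particular, for every $n\in\mathbb N$ and every $R>0$, $$f^n(H^s_p(x,R))\subset H^b_p(x,R).$$ -/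

import Mathlib

open Set Filter Topology TopologicalSpace
open scoped Manifold ContDiff

noncomputable section

/-! ### Metric compactification of a metric space -/

namespace MetricCompactification

/-- The subspace of constant functions in `C(X)`. -/
def constants (X : Type*) [TopologicalSpace X] : AddSubgroup C(X, ℝ) where
  carrier := {f | ∃ c : ℝ, f = ContinuousMap.const X c}
  zero_mem' := ⟨0, rfl⟩
  add_mem' := by
    rintro _ _ ⟨a, rfl⟩ ⟨b, rfl⟩
    exact ⟨a + b, rfl⟩
  neg_mem' := by
    rintro _ ⟨a, rfl⟩
    exact ⟨-a, rfl⟩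

/-- `C_*(X)`: the quotient of `C(X)` (compact-open topology, i.e. local uniform convergence for
locally compact `X`) by the constants, with the quotient topology. -/
abbrev CStar (X : Type*) [TopologicalSpace X] : Type _ := C(X, ℝ) ⧸ constants X

variable {X : Type*} [PseudoMetricSpace X]

/-- The canonical map `x ↦ [d(x, ·)]`. -/
def emb (x : X) : CStar X :=
  QuotientAddGroup.mk (⟨fun z => dist x z, by fun_prop⟩ : C(X, ℝ))

variable (X) in
/-- The metric compactification: the closure of the image of `X` in `C_*(X)`. -/
def compactification : Set (CStar X) := closure (range (emb (X := X)))

variable (X) in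
/-- The metric boundary. -/
def boundary : Set (CStar X) := compactification X \ range (emb (X := X))

/-- The unique representative of a class in `C_*(X)` that vanishes at `p`. -/
def horofunction (p : X) (ξ : CStar X) : X → ℝ :=
  Quotient.liftOn' ξ (fun h z => h z - h p) (by
    intro a b hab
    obtain ⟨c, hc⟩ := QuotientAddGroup.leftRel_apply.mp hab
    funext z
    have h1 := DFunLike.congr_fun hc z
    have h2 := DFunLike.congr_fun hc p
    simp only [ContinuousMap.add_apply, ContinuousMap.neg_apply,
      ContinuousMap.const_apply] at h1 h2
    linarith)

/-- The horoball with pole `p`, center `ξ` and radius `R`. -/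
def horoball (p : X) (ξ : CStar X) (R : ℝ) : Set X :=
  {z | horofunction p ξ z < 1 / 2 * Real.log R}

end MetricCompactification

/-! ### End compactification of a space with a compact exhaustion -/

/-- An end: a decreasing sequence of connected components of the complements of the `K j`. -/
structure SpaceEnd {C : Type*} [TopologicalSpace C] (K : CompactExhaustion C) where
  comp : ℕ → Set C
  isComponent : ∀ j, ∃ y ∈ (K j)ᶜ, comp j = connectedComponentIn (K j)ᶜ y
  decreasing : ∀ j, comp (j + 1) ⊆ comp j

/-- The disjoint union of the space and its set of ends. -/
inductive EndCompactification {C : Type*} [TopologicalSpace C] (K : CompactExhaustion C) where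
  | pt (y : C) : EndCompactification K
  | atEnd (e : SpaceEnd K) : EndCompactification K

namespace EndCompactification

variable {C : Type*} [TopologicalSpace C] {K : CompactExhaustion C}

/-- The basic neighbourhood of the end `e = (F_j)`: the points of `F_j` and the ends that agree
with `e` up to index `j`. -/
def basicNhd (e : SpaceEnd K) (j : ℕ) : Set (EndCompactification K) :=
  pt '' (e.comp j) ∪ atEnd '' {e' | ∀ i ≤ j, e'.comp i = e.comp i}

/-- The prescribed neighbourhood systems. -/
def nhdSystem : EndCompactification K → Filter (EndCompactification K)
  | pt y => map pt (𝓝 y)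
  | atEnd e => ⨅ j, 𝓟 (basicNhd e j)

/-- A set is open iff it belongs to the prescribed neighbourhood system of each of its points. -/
instance : TopologicalSpace (EndCompactification K) := TopologicalSpace.mkOfNhds nhdSystem

end EndCompactification

/-! ### Kobayashi distance -/

/-- The Poincaré distance on the unit disc, with `d(0, ζ) = ½ log ((1 + |ζ|) / (1 - |ζ|))`. -/
def poincareDist (a b : ℂ) : ℝ :=
  Real.artanh ‖(a - b) / (1 - (starRingEnd ℂ) b * a)‖

section Kobayashi

variable (E : Type*) [NormedAddCommGroup E] [NormedSpace ℂ E]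
  {M : Type*} [TopologicalSpace M] [ChartedSpace E M]

/-- `DiscChain E z w ℓ`: there is a finite chain of holomorphic discs joining `z` to `w`, with
total Poincaré length `ℓ`. Discs are maps `ℂ → M` holomorphic on the unit disc; their values
elsewhere play no role. -/
inductive DiscChain : M → M → ℝ → Prop
  | nil (z : M) : DiscChain z z 0
  | cons (φ : ℂ → M) (hφ : MDifferentiableOn 𝓘(ℂ, ℂ) 𝓘(ℂ, E) φ (Metric.ball 0 1))
      (a b : ℂ) (ha : a ∈ Metric.ball (0 : ℂ) 1) (hb : b ∈ Metric.ball (0 : ℂ) 1)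
      (w : M) (l : ℝ) (h : DiscChain (φ b) w l) : DiscChain (φ a) w (poincareDist a b + l)

/-- The Kobayashi (pseudo)distance of a connected complex manifold: the infimum of the lengths of
chains of holomorphic discs joining the two points. -/
def kobayashiDist (z w : M) : ℝ := sInf {l | DiscChain E z w l}

variable {E}

theorem poincareDist_comm (a b : ℂ) : poincareDist a b = poincareDist b a := by
  have h : ‖1 - (starRingEnd ℂ) b * a‖ = ‖1 - (starRingEnd ℂ) a * b‖ := by
    rw [← Complex.norm_conj (1 - (starRingEnd ℂ) b * a)]
    simp [mul_comm]
  unfold poincareDist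
  rw [norm_div, norm_div, h, norm_sub_rev]

theorem poincareDist_nonneg (a b : ℂ) : 0 ≤ poincareDist a b := by
  unfold poincareDist Real.artanh
  set t := ‖(a - b) / (1 - (starRingEnd ℂ) b * a)‖ with ht
  have h0 : 0 ≤ t := norm_nonneg _
  rcases lt_trichotomy t 1 with h | h | h
  · apply Real.log_nonneg
    rw [Real.one_le_sqrt, le_div_iff₀ (by linarith)]
    linarith
  · simp [h]
  · rw [Real.sqrt_eq_zero_of_nonpos (div_nonpos_of_nonneg_of_nonpos (by linarith) (by linarith)),
      Real.log_zero]

theorem DiscChain.nonneg {z w : M} {l : ℝ} (h : DiscChain E z w l) : 0 ≤ l := by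
  induction h with
  | nil z => exact le_rfl
  | cons φ hφ a b ha hb w l h ih => exact add_nonneg (poincareDist_nonneg a b) ih

theorem DiscChain.trans {x y z : M} {l m : ℝ} (h : DiscChain E x y l) (h' : DiscChain E y z m) :
    DiscChain E x z (l + m) := by
  induction h with
  | nil => simpa using h'
  | cons φ hφ a b ha hb w l h ih =>
    rw [add_assoc]
    exact .cons φ hφ a b ha hb _ _ (ih h')

theorem DiscChain.single (φ : ℂ → M)
    (hφ : MDifferentiableOn 𝓘(ℂ, ℂ) 𝓘(ℂ, E) φ (Metric.ball 0 1))
    {a b : ℂ} (ha : a ∈ Metric.ball (0 : ℂ) 1) (hb : b ∈ Metric.ball (0 : ℂ) 1) :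
    DiscChain E (φ a) (φ b) (poincareDist a b) := by
  simpa using DiscChain.cons φ hφ a b ha hb _ _ (.nil (φ b))

theorem DiscChain.symm {x y : M} {l : ℝ} (h : DiscChain E x y l) : DiscChain E y x l := by
  induction h with
  | nil z => exact .nil z
  | cons φ hφ a b ha hb w l h ih =>
    rw [add_comm, poincareDist_comm]
    exact ih.trans (.single φ hφ hb ha)

theorem DiscChain.eventually_exists [IsManifold 𝓘(ℂ, E) ω M] (m : M) :
    ∀ᶠ w in 𝓝 m, ∃ l, DiscChain E m w l := by
  have hop : IsOpen (chartAt E m).target := (chartAt E m).open_target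
  have hm : chartAt E m m ∈ (chartAt E m).target := mem_chart_target E m
  obtain ⟨r, hr, hball⟩ := Metric.isOpen_iff.mp hop _ hm
  have hcont : ContinuousAt (chartAt E m) m := (chartAt E m).continuousAt (mem_chart_source E m)
  filter_upwards [hcont.preimage_mem_nhds (Metric.ball_mem_nhds _ hr),
    (chartAt E m).open_source.mem_nhds (mem_chart_source E m)] with w hw hws
  set v : E := chartAt E m w - chartAt E m m with hv
  have hvr : ‖v‖ < r := by
    have : chartAt E m w ∈ Metric.ball (chartAt E m m) r := hw
    rwa [Metric.mem_ball, dist_eq_norm] at this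
  obtain ⟨t, ht1, ht2⟩ := exists_between ((div_lt_one hr).mpr hvr)
  have ht0 : 0 < t := lt_of_le_of_lt (by positivity) ht1
  have hvt : ‖v‖ < t * r := (div_lt_iff₀ hr).mp ht1
  let g : ℂ → E := fun ζ => chartAt E m m + (ζ / (t : ℂ)) • v
  let φ : ℂ → M := fun ζ => (chartAt E m).symm (g ζ)
  have hmaps : MapsTo g (Metric.ball 0 1) (chartAt E m).target := by
    intro ζ hζ
    apply hball
    have hζ' : ‖ζ‖ < 1 := by simpa using hζ
    have h1 : ‖ζ‖ * ‖v‖ < t * r :=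
      lt_of_le_of_lt (mul_le_of_le_one_left (norm_nonneg _) hζ'.le) hvt
    simp only [g, Metric.mem_ball, dist_eq_norm, add_sub_cancel_left, norm_smul, norm_div,
      Complex.norm_real, Real.norm_eq_abs, abs_of_pos ht0]
    rw [div_mul_eq_mul_div, div_lt_iff₀ ht0]
    linarith
  have hg : Differentiable ℂ g := by
    intro ζ
    simp only [g]
    fun_prop
  have hφ : MDifferentiableOn 𝓘(ℂ, ℂ) 𝓘(ℂ, E) φ (Metric.ball 0 1) := by
    have h1 : MDifferentiableOn 𝓘(ℂ, E) 𝓘(ℂ, E) (chartAt E m).symm (chartAt E m).target :=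
      (contMDiffOn_chart_symm (I := 𝓘(ℂ, E)) (n := ω) (x := m)).mdifferentiableOn (by simp)
    exact h1.comp hg.mdifferentiable.mdifferentiableOn hmaps
  have h0 : φ 0 = m := by
    simp [φ, g, (chartAt E m).left_inv (mem_chart_source E m)]
  have h1 : φ (t : ℂ) = w := by
    have : (t : ℂ) ≠ 0 := by exact_mod_cast ht0.ne'
    simp [φ, g, this, hv, (chartAt E m).left_inv hws]
  have := DiscChain.single φ hφ (a := 0) (b := (t : ℂ)) (by simp)
    (by simpa [abs_of_pos ht0] using ht2)
  rw [h0, h1] at this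
  exact ⟨_, this⟩

theorem DiscChain.exists [IsManifold 𝓘(ℂ, E) ω M] [ConnectedSpace M] (z w : M) :
    ∃ l, DiscChain E z w l := by
  have hcl : IsClopen {w : M | ∃ l, DiscChain E z w l} := by
    constructor
    · rw [← isOpen_compl_iff, isOpen_iff_mem_nhds]
      intro y hy
      filter_upwards [DiscChain.eventually_exists (E := E) y] with u hu ⟨l, hl⟩
      obtain ⟨l', hl'⟩ := hu
      exact hy ⟨_, hl.trans hl'.symm⟩
    · rw [isOpen_iff_mem_nhds]
      rintro y ⟨l, hl⟩
      filter_upwards [DiscChain.eventually_exists (E := E) y] with u hu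
      obtain ⟨l', hl'⟩ := hu
      exact ⟨_, hl.trans hl'⟩
  have hw : w ∈ {w : M | ∃ l, DiscChain E z w l} := by
    rw [hcl.eq_univ ⟨z, 0, .nil z⟩]
    exact mem_univ w
  exact hw

variable (E) in
/-- The set `M`, to be equipped with the Kobayashi distance in place of its manifold topology. -/
def KobayashiSpace (M : Type*) [TopologicalSpace M] [ChartedSpace E M] : Type _ := M

variable (E) in
/-- The identity map from a manifold to itself with the Kobayashi distance. -/
def toKob : M ≃ KobayashiSpace E M := Equiv.refl M

instance [IsManifold 𝓘(ℂ, E) ω M] [ConnectedSpace M] :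
    PseudoMetricSpace (KobayashiSpace E M) where
  dist z w := kobayashiDist E ((toKob E).symm z) ((toKob E).symm w)
  dist_self z := by
    apply le_antisymm
    · exact csInf_le ⟨0, fun l hl => DiscChain.nonneg hl⟩ (.nil _)
    · exact Real.sInf_nonneg fun l hl => DiscChain.nonneg hl
  dist_comm z w := by
    unfold kobayashiDist
    congr 1
    ext l
    exact ⟨DiscChain.symm, DiscChain.symm⟩
  dist_triangle x y z := by
    obtain ⟨l₁, hl₁⟩ := DiscChain.exists (E := E) ((toKob E).symm x) ((toKob E).symm y)
    obtain ⟨l₂, hl₂⟩ := DiscChain.exists (E := E) ((toKob E).symm y) ((toKob E).symm z)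
    refine le_of_forall_pos_lt_add fun ε hε => ?_
    obtain ⟨a, ha, ha'⟩ := Real.lt_sInf_add_pos (s := {l | DiscChain E _ _ l}) ⟨l₁, hl₁⟩
      (half_pos hε)
    obtain ⟨b, hb, hb'⟩ := Real.lt_sInf_add_pos (s := {l | DiscChain E _ _ l}) ⟨l₂, hl₂⟩
      (half_pos hε)
    have h : kobayashiDist E ((toKob E).symm x) ((toKob E).symm z) ≤ a + b :=
      csInf_le ⟨0, fun l hl => DiscChain.nonneg hl⟩
        (DiscChain.trans (E := E) (show DiscChain E _ _ _ from ha) hb)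
    unfold kobayashiDist at h ⊢
    linarith

variable (E M) in
/-- Kobayashi hyperbolicity: the Kobayashi pseudodistance is a distance. -/
def IsKobayashiHyperbolic : Prop := ∀ z w : M, kobayashiDist E z w = 0 → z = w

variable (E M) in
/-- Complete Kobayashi hyperbolicity: the Kobayashi pseudodistance is a distance, and it is
(Cauchy) complete. -/
def IsCompleteKobayashiHyperbolic [IsManifold 𝓘(ℂ, E) ω M] [ConnectedSpace M] : Prop :=
  IsKobayashiHyperbolic E M ∧ CompleteSpace (KobayashiSpace E M)

end Kobayashi

/-- A sequence of self-maps is compactly divergent if for all compact `A`, `B` the image of `A`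
is eventually disjoint from `B`. -/
def CompactlyDivergent {M : Type*} [TopologicalSpace M] (g : ℕ → M → M) : Prop :=
  ∀ A B : Set M, IsCompact A → IsCompact B → ∀ᶠ n in atTop, Disjoint (g n '' A) B

/-! ### Domains in complex manifolds -/

section Domain

variable {X : Type*} [TopologicalSpace X] {Ω : Opens X}

/-- The inclusion of `Ω` in the end compactification of its closure. -/
def toEnd (K : CompactExhaustion (closure (Ω : Set X))) (z : Ω) : EndCompactification K :=
  .pt ⟨z, subset_closure z.2⟩

/-- The boundary of `Ω` in the end compactification of its closure. -/
def endBoundary (K : CompactExhaustion (closure (Ω : Set X))) : Set (EndCompactification K) :=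
  (range (toEnd K))ᶜ

variable (E : Type*) [NormedAddCommGroup E] [NormedSpace ℂ E] [ChartedSpace E X]

/-- The Kobayashi distance `k_Ω(z, w)` tends to infinity as `(z, w)`, with `z, w ∈ Ω`, tends to any
pair of distinct points of the boundary of `Ω` in `X`. -/
def KobayashiDivergesAtBoundary (Ω : Opens X) : Prop :=
  ∀ x ∈ frontier (Ω : Set X), ∀ y ∈ frontier (Ω : Set X), x ≠ y →
    Tendsto (fun q : Ω × Ω => kobayashiDist E q.1 q.2)
      (comap (fun q : Ω × Ω => ((q.1 : X), (q.2 : X))) (𝓝 (x, y))) atTop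

/-- The big horosphere with pole `p`, center `x` and radius `R`. -/
def bigHorosphere (K : CompactExhaustion (closure (Ω : Set X))) (p : Ω)
    (x : EndCompactification K) (R : ℝ) : Set Ω :=
  {z | liminf (fun w : Ω => ((kobayashiDist E z w - kobayashiDist E p w : ℝ) : EReal))
    (comap (toEnd K) (𝓝 x)) < ((1 / 2 * Real.log R : ℝ) : EReal)}

/-- The small horosphere with pole `p`, center `x` and radius `R`. -/
def smallHorosphere (K : CompactExhaustion (closure (Ω : Set X))) (p : Ω)
    (x : EndCompactification K) (R : ℝ) : Set Ω :=
  {z | limsup (fun w : Ω => ((kobayashiDist E z w - kobayashiDist E p w : ℝ) : EReal))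
    (comap (toEnd K) (𝓝 x)) < ((1 / 2 * Real.log R : ℝ) : EReal)}

variable [IsManifold 𝓘(ℂ, E) ω X] [ConnectedSpace Ω]

/-- The horoball of `(Ω, k_Ω)` with pole `p`, center `ξ` and radius `R`. -/
def kobayashiHoroball (p : Ω) (ξ : MetricCompactification.CStar (KobayashiSpace E Ω)) (R : ℝ) :
    Set Ω :=
  toKob E ⁻¹' MetricCompactification.horoball (toKob E p) ξ R

/-- The set `𝓗(x)` of metric boundary points of `(Ω, k_Ω)` that are limits of a sequence of points
of `Ω` converging to `x` in the end compactification. -/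
def metricFiber (K : CompactExhaustion (closure (Ω : Set X))) (x : EndCompactification K) :
    Set (MetricCompactification.CStar (KobayashiSpace E Ω)) :=
  {ξ ∈ MetricCompactification.boundary (KobayashiSpace E Ω) |
    ∃ u : ℕ → Ω, Tendsto (fun n => toEnd K (u n)) atTop (𝓝 x) ∧
      Tendsto (fun n => MetricCompactification.emb (toKob E (u n))) atTop (𝓝 ξ)}

end Domain

end

/-!
Let `m₀ < m₁ < ⋯` be record times of `n ↦ k(p, fⁿ p) → ∞`, so that `k(p, u_k) ≤ k(p, f^j u_k)` for
`u_k = f^{m_k} p` and all `j`. After passing to a subsequence `u_k` tends to some `x` in the end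
compactification and to some metric boundary point `ξ`. As `f` does not expand `k`,
`k(f^j z, f^j u_k) - k(p, f^j u_k) ≤ k(z, u_k) - k(p, u_k) → h_{p,ξ}(z)`. Moreover
`k(u_k, f^j u_k) ≤ k(p, f^j p)`, and this forces `f^j u_k → x`: the Kobayashi balls around the `u_k`
are connected, so if one of them got away from `x` it would meet two disjoint compact sets, which
the divergence of `k` at pairs of distinct boundary points excludes. Hence `f^j` maps horoballs
centred at `ξ` into big horospheres centred at `x`.

That the limit `ξ` is not attained inside uses the Hopf–Rinow theorem: the Kobayashi metric is the
infimum of lengths of curves, so a complete hyperbolic manifold has compact Kobayashi balls.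
-/

/-! ### Hopf–Rinow in length spaces -/

section HopfRinow

variable {Y : Type*} [PseudoMetricSpace Y]

/-- Approximate intermediate points, in the form in which a length space has them: any number
`l > dist x y` splits as `s + (l - s)` between `x` and `y`. -/
def HasApproxIntermediatePoints (Y : Type*) [PseudoMetricSpace Y] : Prop :=
  ∀ (x y : Y) (l s : ℝ), dist x y < l → 0 ≤ s → s ≤ l → ∃ z, dist x z ≤ s ∧ dist z y ≤ l - s

namespace HasApproxIntermediatePoints

theorem closedBall_subset_cthickening (hY : HasApproxIntermediatePoints Y) (x : Y) {r δ R : ℝ}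
    (hr : 0 ≤ r) (hδ : 0 ≤ δ) (hR : R < r + δ) :
    Metric.closedBall x R ⊆ Metric.cthickening δ (Metric.closedBall x r) := by
  intro y hy
  obtain ⟨z, hxz, hzy⟩ := hY x y (r + δ) r ((Metric.mem_closedBall'.mp hy).trans_lt hR) hr
    (le_add_of_nonneg_right hδ)
  rw [add_sub_cancel_left, dist_comm] at hzy
  exact Metric.mem_cthickening_of_dist_le y z δ _ (Metric.mem_closedBall'.mpr hxz) hzy

theorem isCompact_closedBall_of_forall_lt [CompleteSpace Y] (hY : HasApproxIntermediatePoints Y)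
    {x : Y} {R : ℝ} (hR : 0 < R) (h : ∀ r < R, IsCompact (Metric.closedBall x r)) :
    IsCompact (Metric.closedBall x R) := by
  refine isCompact_iff_totallyBounded_isComplete.mpr
    ⟨Metric.totallyBounded_iff.mpr fun ε hε => ?_, Metric.isClosed_closedBall.isComplete⟩
  set r := max (R - ε / 4) 0
  have hrR : r < R := max_lt (by linarith) hR
  obtain ⟨t, ht, htr⟩ := Metric.totallyBounded_iff.mp (h r hrR).totallyBounded (ε / 2) (half_pos hε)
  refine ⟨t, ht, fun y hy => ?_⟩
  have hy' := hY.closedBall_subset_cthickening x (le_max_right _ _) (by linarith : 0 ≤ ε / 3)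
    (by linarith [le_max_left (R - ε / 4) 0] : R < r + ε / 3) hy
  obtain ⟨z, hz, hyz⟩ := Metric.mem_thickening_iff.mp
    (Metric.cthickening_subset_thickening' (half_pos hε) (by linarith) _ hy')
  obtain ⟨c, hct, hzc⟩ := mem_iUnion₂.mp (htr hz)
  exact mem_iUnion₂.mpr ⟨c, hct, (dist_triangle y z c).trans_lt (by
    linarith [Metric.mem_ball.mp hzc])⟩

theorem exists_gt_isCompact_closedBall [LocallyCompactSpace Y] (hY : HasApproxIntermediatePoints Y)
    {x : Y} {r : ℝ} (hr : 0 ≤ r) (h : IsCompact (Metric.closedBall x r)) :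
    ∃ R > r, IsCompact (Metric.closedBall x R) := by
  obtain ⟨δ, hδ, hδc⟩ := h.exists_isCompact_cthickening
  exact ⟨r + δ / 2, by linarith, hδc.of_isClosed_subset Metric.isClosed_closedBall
    (hY.closedBall_subset_cthickening x hr hδ.le (by linarith))⟩

/-- The Hopf–Rinow–Cohn-Vossen theorem. -/
theorem properSpace [CompleteSpace Y] [LocallyCompactSpace Y]
    (hY : HasApproxIntermediatePoints Y) : ProperSpace Y := by
  refine ⟨fun x => ?_⟩
  by_contra! hnc
  obtain ⟨r₀, hr₀⟩ := hnc
  set I : Set ℝ := {r | IsCompact (Metric.closedBall x r)}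
  have hI : ∀ r ∈ I, ∀ s ≤ r, s ∈ I := fun r hr s hs =>
    hr.of_isClosed_subset Metric.isClosed_closedBall (Metric.closedBall_subset_closedBall hs)
  have hbdd : BddAbove I := ⟨r₀, fun r hr => le_of_not_ge fun h => hr₀ (hI r hr r₀ h)⟩
  have hzero : (0 : ℝ) ∈ I := by
    change IsCompact _
    rw [Metric.closedBall_zero']
    exact isCompact_singleton.closure
  obtain ⟨r, hr, hrI⟩ := hY.exists_gt_isCompact_closedBall le_rfl hzero
  have hsup : sSup I ∈ I := hY.isCompact_closedBall_of_forall_lt (hr.trans_le (le_csSup hbdd hrI))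
    fun s hs => by
      obtain ⟨t, ht, hst⟩ := exists_lt_of_lt_csSup ⟨0, hzero⟩ hs
      exact hI t ht s hst.le
  obtain ⟨t, ht, htI⟩ := hY.exists_gt_isCompact_closedBall (le_csSup hbdd hzero) hsup
  exact ht.not_ge (le_csSup hbdd htI)

end HasApproxIntermediatePoints

end HopfRinow

namespace MetricCompactification

variable {Y : Type*} [PseudoMetricSpace Y]

/-- The horofunction `horofunction p ξ` as a continuous function: the section of `C(Y) → C_*(Y)`
that takes values in the functions vanishing at `p`. -/
def representative (p : Y) (ξ : CStar Y) : C(Y, ℝ) :=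
  Quotient.liftOn' ξ (fun h => h - ContinuousMap.const Y (h p)) (by
    intro a b hab
    obtain ⟨c, hc⟩ := QuotientAddGroup.leftRel_apply.mp hab
    rw [neg_add_eq_iff_eq_add] at hc
    ext z
    simp [hc])

theorem coe_representative (p : Y) (ξ : CStar Y) : ⇑(representative p ξ) = horofunction p ξ := by
  induction ξ using Quotient.inductionOn'
  rfl

theorem continuous_representative (p : Y) :
    Continuous (representative p : CStar Y → C(Y, ℝ)) :=
  Continuous.quotient_liftOn' (by fun_prop) _

theorem mk_representative (p : Y) (ξ : CStar Y) :
    (QuotientAddGroup.mk (representative p ξ) : CStar Y) = ξ := by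
  induction ξ using Quotient.inductionOn' with
  | _ h => exact QuotientAddGroup.eq.mpr ⟨h p, by simp [representative]⟩

theorem representative_emb_apply (p x z : Y) :
    representative p (emb x) z = dist x z - dist x p := rfl

theorem representative_emb_mem (p x : Y) :
    representative p (emb x) ∈ {h : C(Y, ℝ) | h p = 0 ∧ LipschitzWith 1 h} := by
  refine ⟨sub_self _, LipschitzWith.of_dist_le_mul fun y z => ?_⟩
  simp only [representative_emb_apply, dist_sub_right, NNReal.coe_one, one_mul]
  exact dist_dist_dist_le_right x y z

theorem continuous_horofunction (p z : Y) :
    Continuous fun ξ : CStar Y => horofunction p ξ z := by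
  simp only [← coe_representative]
  exact (continuous_eval_const z).comp (continuous_representative p)

theorem isCompact_setOf_lipschitzWith_one_pi (p : Y) :
    IsCompact {g : Y → ℝ | g p = 0 ∧ LipschitzWith 1 g} := by
  refine (isCompact_univ_pi fun y => isCompact_closedBall (0 : ℝ) (dist y p)).of_isClosed_subset
    ?_ fun g hg y _ => ?_
  · exact (isClosed_eq (continuous_apply p) continuous_const).inter
      (isClosed_setOfPred_lipschitzWith 1)
  · simpa [hg.1] using hg.2.dist_le_mul y p

theorem isCompact_setOf_lipschitzWith_one (p : Y) :
    IsCompact {h : C(Y, ℝ) | h p = 0 ∧ LipschitzWith 1 h} := by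
  refine ArzelaAscoli.isCompact_of_equicontinuous _ ?_ ?_
  · convert isCompact_setOf_lipschitzWith_one_pi p using 1
    refine Subset.antisymm ?_ fun g hg => ⟨⟨g, hg.2.continuous⟩, hg, rfl⟩
    rintro _ ⟨h, hh, rfl⟩
    exact hh
  · refine Metric.equicontinuous_of_continuity_modulus id tendsto_id _ ?_
    rintro y z ⟨h, -, hh⟩
    simpa using hh.dist_le_mul y z

/-- Gromov: every class in the closure of the embedded space has a `1`-Lipschitz representative,
so compactness is the Arzelà–Ascoli theorem. -/
theorem isCompact_compactification : IsCompact (compactification Y) := by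
  rcases isEmpty_or_nonempty Y with hY | ⟨⟨p⟩⟩
  · simp [compactification, range_eq_empty]
  refine ((isCompact_setOf_lipschitzWith_one p).image
    (QuotientAddGroup.continuous_mk (N := constants Y))).closure_of_subset ?_
  rintro _ ⟨x, rfl⟩
  exact ⟨_, representative_emb_mem p x, mk_representative p (emb x)⟩

/-- If `ξ = emb q`, then `dist (u n) · - dist (u n) q` would converge to `dist q ·` uniformly on the
unit ball around `q`; but it takes values close to `-1` there. -/
theorem mem_boundary_of_tendsto_emb [ProperSpace Y] (hY : HasApproxIntermediatePoints Y) {p : Y}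
    {u : ℕ → Y} (hu : Tendsto (fun n => dist p (u n)) atTop atTop) {ξ : CStar Y}
    (hξ : Tendsto (fun n => emb (u n)) atTop (𝓝 ξ)) : ξ ∈ boundary Y := by
  refine ⟨mem_closure_of_tendsto hξ (Eventually.of_forall fun n => mem_range_self (u n)), ?_⟩
  rintro ⟨q, rfl⟩
  have hunif := Metric.tendstoUniformlyOn_iff.mp
    (ContinuousMap.tendsto_iff_forall_isCompact_tendstoUniformlyOn.mp
      (((continuous_representative q).tendsto _).comp hξ) _ (isCompact_closedBall q 1))
    (1 / 2) one_half_pos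
  obtain ⟨n, hn, hfar⟩ := (hunif.and (hu.eventually_ge_atTop (dist p q + 1))).exists
  obtain ⟨z, hqz, hzu⟩ := hY q (u n) (dist q (u n) + 1 / 2) 1 (by linarith) zero_le_one
    (by linarith [dist_triangle p q (u n)])
  have hclose := hn z (Metric.mem_closedBall'.mpr hqz)
  simp only [Function.comp_apply, representative_emb_apply, Real.dist_eq, dist_self, sub_zero,
    dist_comm (u n), abs_lt] at hclose
  linarith [dist_nonneg (x := q) (y := z), hclose.2]

theorem exists_subseq_tendsto_emb_boundary [ProperSpace Y] (hY : HasApproxIntermediatePoints Y)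
    {p : Y} {u : ℕ → Y} (hu : Tendsto (fun n => dist p (u n)) atTop atTop) :
    ∃ ξ ∈ boundary Y, ∃ φ : ℕ → ℕ, StrictMono φ ∧
      Tendsto (fun n => emb (u (φ n))) atTop (𝓝 ξ) := by
  obtain ⟨ξ, -, φ, hφ, hξ⟩ := isCompact_compactification.tendsto_subseq
    fun n => subset_closure (mem_range_self (u n))
  exact ⟨ξ, mem_boundary_of_tendsto_emb hY (hu.comp hφ.tendsto_atTop) hξ, φ, hφ, hξ⟩

end MetricCompactification

/-! ### The Kobayashi distance as a length metric -/

theorem tanh_sub_div_one_sub_mul (s t : ℝ) :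
    (Real.tanh s - Real.tanh t) / (1 - Real.tanh t * Real.tanh s) = Real.tanh (s - t) := by
  have hs := (Real.cosh_pos s).ne'
  have ht := (Real.cosh_pos t).ne'
  have hst := (Real.cosh_pos (s - t)).ne'
  rw [Real.cosh_sub] at hst
  have hne : 1 - Real.sinh t / Real.cosh t * (Real.sinh s / Real.cosh s) ≠ 0 := by
    refine left_ne_zero_of_mul (b := Real.cosh s * Real.cosh t) ?_
    convert hst using 1
    field_simp
  simp only [Real.tanh_eq_sinh_div_cosh, Real.sinh_sub, Real.cosh_sub]
  rw [div_eq_div_iff hne hst]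
  field_simp

theorem abs_tanh (s : ℝ) : |Real.tanh s| = Real.tanh |s| := by
  simp only [Real.tanh_eq_sinh_div_cosh, abs_div, Real.abs_sinh, Real.cosh_abs,
    abs_of_pos (Real.cosh_pos s)]

theorem poincareDist_tanh (s t : ℝ) :
    poincareDist (Real.tanh s : ℝ) (Real.tanh t : ℝ) = |s - t| := by
  unfold poincareDist
  rw [Complex.conj_ofReal]
  norm_cast
  rw [tanh_sub_div_one_sub_mul, Real.norm_eq_abs, abs_tanh, Real.artanh_tanh]

theorem ofReal_tanh_mem_ball (s : ℝ) : ((Real.tanh s : ℝ) : ℂ) ∈ Metric.ball (0 : ℂ) 1 := by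
  rw [mem_ball_zero_iff, Complex.norm_real]
  exact Real.abs_tanh_lt_one s

theorem one_sub_conj_mul_ne_zero {a z : ℂ} (ha : ‖a‖ < 1) (hz : ‖z‖ < 1) :
    1 - (starRingEnd ℂ) a * z ≠ 0 := by
  refine sub_ne_zero.mpr fun h => ?_
  have hlt : ‖(starRingEnd ℂ) a * z‖ < 1 := by
    rw [norm_mul, Complex.norm_conj]
    exact mul_lt_one_of_nonneg_of_lt_one_left (norm_nonneg a) ha hz.le
  rw [← h, norm_one] at hlt
  exact lt_irrefl _ hlt

theorem norm_mobius_lt_one {a z : ℂ} (ha : ‖a‖ < 1) (hz : ‖z‖ < 1) :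
    ‖(z - a) / (1 - (starRingEnd ℂ) a * z)‖ < 1 := by
  rw [norm_div, div_lt_one (norm_pos_iff.mpr (one_sub_conj_mul_ne_zero ha hz)),
    ← sq_lt_sq₀ (norm_nonneg _) (norm_nonneg _), ← sub_pos]
  have hfactor : ‖1 - (starRingEnd ℂ) a * z‖ ^ 2 - ‖z - a‖ ^ 2 =
      (1 - ‖a‖ ^ 2) * (1 - ‖z‖ ^ 2) := by
    simp only [Complex.sq_norm, Complex.normSq_apply, Complex.sub_re, Complex.sub_im,
      Complex.mul_re, Complex.mul_im, Complex.conj_re, Complex.conj_im, Complex.one_re,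
      Complex.one_im]
    ring
  rw [hfactor]
  exact mul_pos (sub_pos.mpr (pow_lt_one₀ (norm_nonneg a) ha two_ne_zero))
    (sub_pos.mpr (pow_lt_one₀ (norm_nonneg z) hz two_ne_zero))

theorem differentiableOn_mobius {a : ℂ} (ha : ‖a‖ < 1) :
    DifferentiableOn ℂ (fun z => (z - a) / (1 - (starRingEnd ℂ) a * z)) (Metric.ball 0 1) :=
  fun z hz => DifferentiableAt.differentiableWithinAt <| DifferentiableAt.div (by fun_prop)
    (by fun_prop) (one_sub_conj_mul_ne_zero ha (mem_ball_zero_iff.mp hz))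

theorem mobius_neg_mobius {a b : ℂ} (ha : ‖a‖ < 1) (hb : ‖b‖ < 1) :
    ((b - a) / (1 - (starRingEnd ℂ) a * b) - -a) /
      (1 - (starRingEnd ℂ) (-a) * ((b - a) / (1 - (starRingEnd ℂ) a * b))) = b := by
  have hmul := div_mul_cancel₀ (b - a) (one_sub_conj_mul_ne_zero ha hb)
  rw [div_eq_iff (one_sub_conj_mul_ne_zero (by rwa [norm_neg]) (norm_mobius_lt_one ha hb)), map_neg]
  linear_combination hmul

/-- Rotate the disc and apply the automorphism that moves `0` to `a`. -/
theorem exists_disc_through {a b : ℂ} (ha : ‖a‖ < 1) (hb : ‖b‖ < 1) :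
    ∃ g : ℂ → ℂ, DifferentiableOn ℂ g (Metric.ball 0 1) ∧
      MapsTo g (Metric.ball 0 1) (Metric.ball 0 1) ∧ g 0 = a ∧
      g (Real.tanh (poincareDist a b) : ℝ) = b := by
  set c : ℂ := (b - a) / (1 - (starRingEnd ℂ) a * b)
  have hc_lt : ‖c‖ < 1 := norm_mobius_lt_one ha hb
  have htanh : Real.tanh (poincareDist a b) = ‖c‖ := by
    rw [poincareDist_comm]
    exact Real.tanh_artanh ⟨neg_one_lt_zero.trans_le (norm_nonneg c), hc_lt⟩
  have ha' : ‖-a‖ < 1 := by rwa [norm_neg]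
  set e : ℂ := Complex.exp (Complex.arg c * Complex.I)
  have hrot : MapsTo (· * e) (Metric.ball (0 : ℂ) 1) (Metric.ball 0 1) := fun ζ hζ => by
    simpa [e, Complex.norm_exp_ofReal_mul_I] using hζ
  refine ⟨fun ζ => (ζ * e - -a) / (1 - (starRingEnd ℂ) (-a) * (ζ * e)),
    (differentiableOn_mobius ha').comp (by fun_prop) hrot, fun ζ hζ => ?_, by simp, ?_⟩
  · exact mem_ball_zero_iff.mpr (norm_mobius_lt_one ha' (mem_ball_zero_iff.mp (hrot hζ)))
  · simp only [htanh, e, Complex.norm_mul_exp_arg_mul_I]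
    exact mobius_neg_mobius ha hb

theorem exists_mem_frontier_of_isPreconnected {Y : Type*} [TopologicalSpace Y] {S T : Set Y}
    (hS : IsPreconnected S) {a b : Y} (ha : a ∈ S) (haT : a ∈ T) (hb : b ∈ S) (hbT : b ∉ T) :
    ∃ s ∈ S, s ∈ frontier T := by
  by_contra! hcon
  obtain ⟨c, -, hcT, hcT'⟩ := hS (interior T) (closure T)ᶜ isOpen_interior
    isClosed_closure.isOpen_compl
    (fun s hs => or_iff_not_imp_left.mpr fun hi hc => hcon s hs ⟨hc, hi⟩)
    ⟨a, ha, not_not.mp fun hi => hcon a ha ⟨subset_closure haT, hi⟩⟩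
    ⟨b, hb, fun hc => hcon b hb ⟨hc, fun hi => hbT (interior_subset hi)⟩⟩
  exact hcT' (interior_subset_closure hcT)

section DiscChain

variable {E : Type*} [NormedAddCommGroup E] [NormedSpace ℂ E]
  {M : Type*} [TopologicalSpace M] [ChartedSpace E M]

theorem exists_unit_speed_curve {φ : ℂ → M}
    (hφ : MDifferentiableOn 𝓘(ℂ, ℂ) 𝓘(ℂ, E) φ (Metric.ball 0 1)) {a b : ℂ}
    (ha : a ∈ Metric.ball (0 : ℂ) 1) (hb : b ∈ Metric.ball (0 : ℂ) 1) :
    ∃ γ : ℝ → M, Continuous γ ∧ γ 0 = φ a ∧ γ (poincareDist a b) = φ b ∧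
      ∀ s t, DiscChain E (γ s) (γ t) |s - t| := by
  obtain ⟨g, hg, hgm, hga, hgb⟩ :=
    exists_disc_through (mem_ball_zero_iff.mp ha) (mem_ball_zero_iff.mp hb)
  have hψ : MDifferentiableOn 𝓘(ℂ, ℂ) 𝓘(ℂ, E) (φ ∘ g) (Metric.ball 0 1) :=
    hφ.comp hg.mdifferentiableOn hgm
  have htanh : Continuous Real.tanh := by
    simp only [funext Real.tanh_eq_sinh_div_cosh]
    exact Real.continuous_sinh.div Real.continuous_cosh fun s => (Real.cosh_pos s).ne'
  refine ⟨fun s => φ (g (Real.tanh s : ℝ)), ?_, by simp [hga], congrArg φ hgb, fun s t => ?_⟩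
  · exact hψ.continuousOn.comp_continuous (Complex.continuous_ofReal.comp htanh)
      ofReal_tanh_mem_ball
  · rw [← poincareDist_tanh]
    exact .single _ hψ (ofReal_tanh_mem_ball s) (ofReal_tanh_mem_ball t)

namespace DiscChain

theorem exists_continuous_curve {z w : M} {l : ℝ} (h : DiscChain E z w l) :
    ∃ γ : ℝ → M, Continuous γ ∧ γ 0 = z ∧ γ l = w ∧
      ∀ s ∈ Icc 0 l, DiscChain E z (γ s) s ∧ DiscChain E (γ s) w (l - s) := by
  induction h with
  | nil z =>
    refine ⟨fun _ => z, continuous_const, rfl, rfl, fun s hs => ?_⟩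
    obtain rfl : s = 0 := le_antisymm hs.2 hs.1
    exact ⟨.nil z, by simpa using DiscChain.nil z⟩
  | cons φ hφ a b ha hb w l h ih =>
    obtain ⟨γ₁, hγ₁, hγ₁a, hγ₁b, hdist⟩ := exists_unit_speed_curve hφ ha hb
    obtain ⟨γ₂, hγ₂, hγ₂b, hγ₂w, hcut⟩ := ih
    set d := poincareDist a b
    have hd : 0 ≤ d := poincareDist_nonneg a b
    refine ⟨fun s => if s ≤ d then γ₁ s else γ₂ (s - d), ?_, ?_, ?_, ?_⟩
    · exact hγ₁.if_le (hγ₂.comp (by fun_prop)) continuous_id continuous_const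
        fun s hs => by rw [hs, sub_self, hγ₁b, hγ₂b]
    · exact (if_pos hd).trans hγ₁a
    · rcases h.nonneg.eq_or_lt with rfl | hl
      · simp [hγ₁b, ← hγ₂b, hγ₂w]
      · simp [hl, hγ₂w]
    · intro s hs
      beta_reduce
      split_ifs with hsd
      · have hfst := hdist 0 s
        have hsnd := (hdist s d).trans (hγ₁b ▸ h)
        rw [hγ₁a, zero_sub, abs_neg, abs_of_nonneg hs.1] at hfst
        rw [abs_sub_comm, abs_of_nonneg (sub_nonneg.mpr hsd), sub_add_eq_add_sub] at hsnd
        exact ⟨hfst, hsnd⟩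
      · obtain ⟨hfst, hsnd⟩ := hcut (s - d) ⟨by linarith, by linarith [hs.2]⟩
        refine ⟨?_, by rwa [show d + l - s = l - (s - d) by ring]⟩
        simpa [d] using DiscChain.cons φ hφ a b ha hb _ _ hfst

theorem map {F N : Type*} [NormedAddCommGroup F] [NormedSpace ℂ F] [TopologicalSpace N]
    [ChartedSpace F N] {f : M → N} (hf : MDifferentiable 𝓘(ℂ, E) 𝓘(ℂ, F) f) {z w : M} {l : ℝ}
    (h : DiscChain E z w l) : DiscChain F (f z) (f w) l := by
  induction h with
  | nil z => exact .nil _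
  | cons φ hφ a b ha hb w l _ ih =>
    exact .cons (f ∘ φ) (hf.comp_mdifferentiableOn hφ) a b ha hb _ _ ih

end DiscChain

theorem exists_mdifferentiableOn_chartAt_symm_line [IsManifold 𝓘(ℂ, E) ω M] (m : M) :
    ∃ r > 0, ∀ v : E, ‖v‖ < r → MDifferentiableOn 𝓘(ℂ, ℂ) 𝓘(ℂ, E)
      (fun ζ : ℂ => (chartAt E m).symm (chartAt E m m + ζ • v)) (Metric.ball 0 1) := by
  obtain ⟨r, hr, hball⟩ := Metric.isOpen_iff.mp (chartAt E m).open_target _ (mem_chart_target E m)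
  refine ⟨r, hr, fun v hv => ?_⟩
  have hsymm : MDifferentiableOn 𝓘(ℂ, E) 𝓘(ℂ, E) (chartAt E m).symm (chartAt E m).target :=
    (contMDiffOn_chart_symm (I := 𝓘(ℂ, E)) (n := ω) (x := m)).mdifferentiableOn (by simp)
  have hline : Differentiable ℂ fun ζ : ℂ => chartAt E m m + ζ • v := by fun_prop
  refine hsymm.comp hline.mdifferentiable.mdifferentiableOn fun ζ hζ => hball ?_
  rw [mem_ball_iff_norm, add_sub_cancel_left, norm_smul]
  exact (mul_le_of_le_one_left (norm_nonneg v) (mem_ball_zero_iff.mp hζ).le).trans_lt hv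

theorem DiscChain.eventually [IsManifold 𝓘(ℂ, E) ω M] (m : M) {ε : ℝ} (hε : 0 < ε) :
    ∀ᶠ w in 𝓝 m, DiscChain E m w ε := by
  obtain ⟨r, hr, hdisc⟩ := exists_mdifferentiableOn_chartAt_symm_line (E := E) m
  set τ := ((Real.tanh ε : ℝ) : ℂ) with hτ
  have hτ_ne : τ ≠ 0 :=
    Complex.ofReal_ne_zero.mpr (Real.tanh_zero ▸ Real.tanh_injective.ne hε.ne')
  let v : M → E := fun w => τ⁻¹ • (chartAt E m w - chartAt E m m)
  have hv : ContinuousAt v m :=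
    (((chartAt E m).continuousAt (mem_chart_source E m)).sub continuousAt_const).const_smul _
  have hvm : ‖v m‖ < r := by simpa [v] using hr
  filter_upwards [hv.norm.eventually_lt continuousAt_const hvm,
    (chartAt E m).open_source.mem_nhds (mem_chart_source E m)] with w hw hws
  have h := DiscChain.single _ (hdisc (v w) hw) (a := ((Real.tanh 0 : ℝ) : ℂ))
    (ofReal_tanh_mem_ball 0) (ofReal_tanh_mem_ball ε)
  rw [poincareDist_tanh, zero_sub, abs_neg, abs_of_pos hε, ← hτ] at h
  simpa [v, hτ_ne, (chartAt E m).left_inv hws] using h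

end DiscChain

section KobayashiDist

variable {E : Type*} [NormedAddCommGroup E] [NormedSpace ℂ E]
  {M : Type*} [TopologicalSpace M] [ChartedSpace E M]

theorem kobayashiDist_le_of_discChain {z w : M} {l : ℝ} (h : DiscChain E z w l) :
    kobayashiDist E z w ≤ l :=
  csInf_le ⟨0, fun _ => DiscChain.nonneg⟩ h

theorem kobayashiDist_iterate_le {f : M → M}
    (hf : ∀ z w, kobayashiDist E (f z) (f w) ≤ kobayashiDist E z w) (n : ℕ) (z w : M) :
    kobayashiDist E (f^[n] z) (f^[n] w) ≤ kobayashiDist E z w := by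
  induction n generalizing z w with
  | zero => rfl
  | succ n ih => exact (ih (f z) (f w)).trans (hf z w)

variable [IsManifold 𝓘(ℂ, E) ω M] [ConnectedSpace M]

theorem exists_discChain_lt {z w : M} {l : ℝ} (h : kobayashiDist E z w < l) :
    ∃ l' < l, DiscChain E z w l' := by
  obtain ⟨l', hl', hlt⟩ := exists_lt_of_csInf_lt (DiscChain.exists (E := E) z w) h
  exact ⟨l', hlt, hl'⟩

theorem kobayashiDist_map_le {F N : Type*} [NormedAddCommGroup F] [NormedSpace ℂ F]
    [TopologicalSpace N] [ChartedSpace F N] {f : M → N} (hf : MDifferentiable 𝓘(ℂ, E) 𝓘(ℂ, F) f)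
    (z w : M) : kobayashiDist F (f z) (f w) ≤ kobayashiDist E z w :=
  le_csInf (DiscChain.exists z w) fun _ hl => kobayashiDist_le_of_discChain (DiscChain.map hf hl)

theorem dist_toKob (z w : M) : dist (toKob E z) (toKob E w) = kobayashiDist E z w := rfl

theorem kobayashiDist_self (z : M) : kobayashiDist E z z = 0 :=
  dist_self (toKob E z)

theorem kobayashiDist_nonneg (z w : M) : 0 ≤ kobayashiDist E z w :=
  dist_nonneg (x := toKob E z) (y := toKob E w)

theorem kobayashiDist_comm (z w : M) : kobayashiDist E z w = kobayashiDist E w z :=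
  dist_comm (toKob E z) (toKob E w)

theorem kobayashiDist_triangle (x y z : M) :
    kobayashiDist E x z ≤ kobayashiDist E x y + kobayashiDist E y z :=
  dist_triangle (toKob E x) (toKob E y) (toKob E z)

theorem isPreconnected_kobayashiBall (z : M) (r : ℝ) :
    IsPreconnected {w : M | kobayashiDist E z w < r} := by
  refine isPreconnected_of_forall z fun w hw => ?_
  obtain ⟨l, hl, hchain⟩ := exists_discChain_lt hw
  obtain ⟨γ, hγ, hγz, hγw, hcut⟩ := hchain.exists_continuous_curve
  refine ⟨γ '' Icc 0 l, ?_, ⟨0, left_mem_Icc.mpr hchain.nonneg, hγz⟩,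
    ⟨l, right_mem_Icc.mpr hchain.nonneg, hγw⟩, isPreconnected_Icc.image γ hγ.continuousOn⟩
  rintro _ ⟨s, hs, rfl⟩
  exact (kobayashiDist_le_of_discChain (hcut s hs).1).trans_lt (hs.2.trans_lt hl)

theorem hasApproxIntermediatePoints_kobayashiSpace :
    HasApproxIntermediatePoints (KobayashiSpace E M) := by
  intro x y l s hxy hs hsl
  obtain ⟨l', hl', hchain⟩ : ∃ l' < l, DiscChain E ((toKob E).symm x) ((toKob E).symm y) l' :=
    exists_discChain_lt hxy
  rcases le_total s l' with hsl' | hsl'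
  · obtain ⟨γ, -, -, -, hcut⟩ := hchain.exists_continuous_curve
    obtain ⟨hfst, hsnd⟩ := hcut s ⟨hs, hsl'⟩
    exact ⟨toKob E (γ s), kobayashiDist_le_of_discChain hfst,
      (kobayashiDist_le_of_discChain hsnd).trans (sub_le_sub_right hl'.le s)⟩
  · exact ⟨y, (kobayashiDist_le_of_discChain hchain).trans hsl', by simpa using hsl⟩

theorem continuous_toKob : Continuous (toKob E : M → KobayashiSpace E M) := by
  refine continuous_iff_continuousAt.mpr fun m => Metric.tendsto_nhds.mpr fun ε hε => ?_
  filter_upwards [DiscChain.eventually (E := E) m (half_pos hε)] with w hw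
  rw [dist_comm, dist_toKob]
  exact (kobayashiDist_le_of_discChain hw).trans_lt (half_lt_self hε)

theorem continuous_kobayashiDist (p : M) : Continuous fun z => kobayashiDist E p z :=
  continuous_const.dist (continuous_toKob (E := E))

/-- Barth's theorem: the Kobayashi balls around `m` are connected, so those that miss the frontier
of a compact neighbourhood of `m` are contained in it. -/
theorem continuous_toKob_symm [T2Space M] [LocallyCompactSpace M]
    (h : IsKobayashiHyperbolic E M) : Continuous ((toKob E).symm : KobayashiSpace E M → M) := by
  refine continuous_iff_continuousAt.mpr ((toKob E).forall_congr_right.mp fun m U hU => ?_)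
  rw [Equiv.symm_apply_apply] at hU
  obtain ⟨L, hL, hLU, hLc⟩ := local_compact_nhds hU
  have hpos : ∀ s ∈ frontier L, 0 < kobayashiDist E m s := fun s hs =>
    (kobayashiDist_nonneg m s).lt_of_ne' fun h0 => by
      rw [← h m s h0] at hs
      exact hs.2 (mem_interior_iff_mem_nhds.mpr hL)
  obtain ⟨δ, hδ, hle⟩ := (hLc.of_isClosed_subset isClosed_frontier
    hLc.isClosed.frontier_subset).exists_forall_le'
      (continuous_kobayashiDist m).continuousOn hpos
  refine mem_map.mpr (mem_of_superset (Metric.ball_mem_nhds _ hδ) fun y hy => hLU ?_)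
  by_contra hyL
  obtain ⟨s, hs, hsL⟩ := exists_mem_frontier_of_isPreconnected (isPreconnected_kobayashiBall m δ)
    ((kobayashiDist_self m).trans_lt hδ) (mem_of_mem_nhds hL) (Metric.mem_ball'.mp hy) hyL
  exact (hle s hsL).not_gt hs

/-- A hyperbolic manifold with its own topology is its Kobayashi metric space. -/
def kobayashiHomeomorph [T2Space M] [LocallyCompactSpace M] (h : IsKobayashiHyperbolic E M) :
    M ≃ₜ KobayashiSpace E M where
  toEquiv := toKob E
  continuous_toFun := continuous_toKob
  continuous_invFun := continuous_toKob_symm h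

theorem IsCompleteKobayashiHyperbolic.properSpace [T2Space M] [LocallyCompactSpace M]
    (h : IsCompleteKobayashiHyperbolic E M) : ProperSpace (KobayashiSpace E M) := by
  have := h.2
  have := (kobayashiHomeomorph h.1).symm.isClosedEmbedding.locallyCompactSpace
  exact hasApproxIntermediatePoints_kobayashiSpace.properSpace

theorem CompactlyDivergent.tendsto_kobayashiDist [T2Space M] [LocallyCompactSpace M]
    (h : IsCompleteKobayashiHyperbolic E M) {g : ℕ → M → M} (hg : CompactlyDivergent g) (p : M) :
    Tendsto (fun n => kobayashiDist E p (g n p)) atTop atTop := by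
  have := h.properSpace
  refine tendsto_atTop.mpr fun r => ?_
  have hball : IsCompact {w : M | kobayashiDist E p w ≤ r} := by
    convert (kobayashiHomeomorph h.1).isCompact_preimage.mpr (isCompact_closedBall (toKob E p) r)
    ext w
    exact (Metric.mem_closedBall' (x := toKob E p) (y := toKob E w)).symm
  filter_upwards [hg {p} _ isCompact_singleton hball] with n hn
  by_contra! hlt
  exact disjoint_left.mp hn (mem_image_of_mem _ rfl) hlt.le

end KobayashiDist

/-! ### Convergence in the end compactification -/

theorem weaklyLocallyCompactSpace_of_compactExhaustion {C : Type*} [TopologicalSpace C]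
    (K : CompactExhaustion C) : WeaklyLocallyCompactSpace C :=
  ⟨fun z => (K.exists_mem_nhds z).imp' K fun j hj => ⟨K.isCompact j, hj⟩⟩

namespace EndCompactification

variable {C : Type*} [TopologicalSpace C] {K : CompactExhaustion C}

theorem pt_injective : Function.Injective (pt : C → EndCompactification K) := fun _ _ h => by
  injection h

theorem nhdSystem_le_nhds (x : EndCompactification K) : nhdSystem x ≤ 𝓝 x :=
  (nhds_basis_opens x).ge_iff.mpr fun _ hU => hU.2 x hU.1

theorem isOpenEmbedding_pt : IsOpenEmbedding (pt : C → EndCompactification K) := by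
  refine .of_continuous_injective_isOpenMap ?_ pt_injective fun U hU => ?_
  · exact continuous_iff_continuousAt.mpr fun y => nhdSystem_le_nhds (pt y)
  · rintro _ ⟨y, hy, rfl⟩
    exact image_mem_map (hU.mem_nhds hy)

theorem tendsto_atEnd {α : Type*} {l : Filter α} {u : α → C} {e : SpaceEnd K}
    (h : ∀ j, ∀ᶠ n in l, u n ∈ e.comp j) :
    Tendsto (fun n => (pt (u n) : EndCompactification K)) l (𝓝 (atEnd e)) := by
  refine Tendsto.mono_right (tendsto_iInf.mpr fun j => tendsto_principal.mpr ?_)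
    (nhdSystem_le_nhds (atEnd e))
  exact (h j).mono fun n hn => Or.inl (mem_image_of_mem pt hn)

theorem comp_subset_compl (e : SpaceEnd K) (j : ℕ) : e.comp j ⊆ (K j)ᶜ := by
  obtain ⟨y, -, hy⟩ := e.isComponent j
  exact hy ▸ connectedComponentIn_subset _ _

theorem subset_comp_of_isPreconnected {e : SpaceEnd K} {j : ℕ} {S : Set C} (hS : IsPreconnected S)
    {a : C} (haS : a ∈ S) (ha : a ∈ e.comp j) (hSK : Disjoint S (K j)) : S ⊆ e.comp j := by
  obtain ⟨y, -, hy⟩ := e.isComponent j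
  rw [hy] at ha ⊢
  rw [connectedComponentIn_eq ha]
  exact hS.subset_connectedComponentIn haS hSK.subset_compl_right

/-- The components of the complements of the `K j` need not be open, so the basic neighbourhoods
of an end need not be open either. -/
theorem exists_isOpen_atEnd_of_disjoint {A : Set C} (hA : IsClosed A) {e : SpaceEnd K} {j : ℕ}
    (hj : Disjoint (e.comp j) A) :
    ∃ U : Set (EndCompactification K), IsOpen U ∧ atEnd e ∈ U ∧ ∀ y ∈ A, pt y ∉ U := by
  refine ⟨pt '' Aᶜ ∪ atEnd '' {e' | ∃ i, Disjoint (e'.comp i) A}, ?_,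
    Or.inr ⟨e, ⟨j, hj⟩, rfl⟩, ?_⟩
  · rintro x (⟨y, hy, rfl⟩ | ⟨e', ⟨i, hi⟩, rfl⟩)
    · exact mem_of_superset (image_mem_map (hA.isOpen_compl.mem_nhds hy)) subset_union_left
    · refine mem_of_superset (mem_iInf_of_mem i (mem_principal_self (basicNhd e' i))) ?_
      rintro x (⟨y, hy, rfl⟩ | ⟨e'', h'', rfl⟩)
      · exact Or.inl ⟨y, hi.notMem_of_mem_left hy, rfl⟩
      · exact Or.inr ⟨e'', ⟨i, by rwa [h'' i le_rfl]⟩, rfl⟩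
  · rintro y hy (⟨y', hy', h⟩ | ⟨e', -, h⟩)
    · exact hy' (pt_injective h ▸ hy)
    · cases h

theorem eventually_notMem_of_tendsto_atEnd [T2Space C] {α : Type*} {l : Filter α} {u : α → C}
    {e : SpaceEnd K}
    (h : Tendsto (fun n => (pt (u n) : EndCompactification K)) l (𝓝 (atEnd e))) (j : ℕ) :
    ∀ᶠ n in l, u n ∉ K j := by
  obtain ⟨U, hU, heU, hUK⟩ := exists_isOpen_atEnd_of_disjoint (K.isCompact j).isClosed
    (e := e) (disjoint_compl_left.mono_left (comp_subset_compl e j))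
  exact (h.eventually_mem (hU.mem_nhds heU)).mono fun n hn hK => hUK _ hK hn

theorem isClosed_image_of_eventually_notMem [T1Space C] {u : ℕ → C}
    (h : ∀ j, ∀ᶠ n in atTop, u n ∉ K j) (s : Set ℕ) : IsClosed (u '' s) := by
  rw [← isOpen_compl_iff, isOpen_iff_mem_nhds]
  intro y hy
  obtain ⟨j, hj⟩ := K.exists_mem_nhds y
  obtain ⟨N, hN⟩ := eventually_atTop.mp (h j)
  have hfin : (u '' (s ∩ Iio N)).Finite := ((finite_Iio N).subset inter_subset_right).image u
  have hy' : y ∉ u '' (s ∩ Iio N) := fun hmem => hy (image_mono inter_subset_left hmem)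
  filter_upwards [hj, hfin.isClosed.isOpen_compl.mem_nhds hy'] with z hzK hz
  rintro ⟨n, hn, rfl⟩
  exact hz ⟨n, ⟨hn, not_le.mp fun hle => hN n hle hzK⟩, rfl⟩

theorem eventually_mem_comp_of_tendsto_atEnd [T2Space C] {u : ℕ → C} {e : SpaceEnd K}
    (h : Tendsto (fun n => (pt (u n) : EndCompactification K)) atTop (𝓝 (atEnd e))) (j : ℕ) :
    ∀ᶠ n in atTop, u n ∈ e.comp j := by
  have hclosed : IsClosed (u '' {n | u n ∉ e.comp j}) :=
    isClosed_image_of_eventually_notMem (eventually_notMem_of_tendsto_atEnd h) _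
  have hdisj : Disjoint (e.comp j) (u '' {n | u n ∉ e.comp j}) := by
    rw [disjoint_right]
    rintro _ ⟨n, hn, rfl⟩
    exact hn
  obtain ⟨U, hU, heU, hUA⟩ := exists_isOpen_atEnd_of_disjoint hclosed hdisj
  filter_upwards [h.eventually_mem (hU.mem_nhds heU)] with n hn
  by_contra hnot
  exact hUA _ (mem_image_of_mem u hnot) hn

end EndCompactification

/-- The sets `S i` eventually separate points along `l` if any two distinct points have
neighbourhoods such that, for all late `i`, `S i` does not meet both. This is the form in which a
lower bound on a distance near pairs of distinct boundary points is used. -/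
def EventuallySeparatesPoints {ι C : Type*} [TopologicalSpace C] (S : ι → Set C)
    (l : Filter ι) : Prop :=
  ∀ a b, a ≠ b → ∀ᶠ q : ι × C × C in l ×ˢ 𝓝 (a, b), ¬(q.2.1 ∈ S q.1 ∧ q.2.2 ∈ S q.1)

namespace EventuallySeparatesPoints

variable {C : Type*} [TopologicalSpace C]

theorem eventually_disjoint {ι : Type*} {S : ι → Set C} {l : Filter ι}
    (hS : EventuallySeparatesPoints S l) {A B : Set C} (hA : IsCompact A) (hB : IsCompact B)
    (hAB : Disjoint A B) : ∀ᶠ i in l, Disjoint (S i) A ∨ Disjoint (S i) B := by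
  have hprod : {q : ι × C × C | ¬(q.2.1 ∈ S q.1 ∧ q.2.2 ∈ S q.1)} ∈ l ×ˢ 𝓝ˢ (A ×ˢ B) :=
    (hA.prod hB).mem_prod_nhdsSet_of_forall fun q hq => hS q.1 q.2 (hAB.ne_of_mem hq.1 hq.2)
  obtain ⟨s, hs, t, ht, hst⟩ := mem_prod_iff.mp hprod
  filter_upwards [hs] with i hi
  by_contra! hmeet
  obtain ⟨⟨a, haS, haA⟩, b, hbS, hbB⟩ := hmeet.imp not_disjoint_iff.mp not_disjoint_iff.mp
  exact hst (mk_mem_prod hi (subset_of_mem_nhdsSet ht (mk_mem_prod haA hbB))) ⟨haS, hbS⟩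

variable [T2Space C] {S : ℕ → Set C} {u v : ℕ → C}

theorem tendsto_nhds [WeaklyLocallyCompactSpace C] (hS : EventuallySeparatesPoints S atTop)
    (hconn : ∀ n, IsPreconnected (S n)) (hu : ∀ n, u n ∈ S n) (hv : ∀ n, v n ∈ S n) {y : C}
    (hy : Tendsto u atTop (𝓝 y)) : Tendsto v atTop (𝓝 y) := by
  refine tendsto_def.mpr fun U hU => ?_
  obtain ⟨L, hL, hLU, hLc⟩ := local_compact_nhds hU
  obtain ⟨L', hL', hL'L, hL'c⟩ := local_compact_nhds (interior_mem_nhds.mpr hL)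
  have hdisj := hS.eventually_disjoint hL'c (hLc.of_isClosed_subset isClosed_frontier
    hLc.isClosed.frontier_subset) (disjoint_interior_frontier.mono_left hL'L)
  filter_upwards [hdisj, hy.eventually_mem hL'] with n hn hun
  by_contra hvU
  obtain ⟨s, hsS, hsL⟩ := exists_mem_frontier_of_isPreconnected (hconn n) (hu n)
    (interior_subset (hL'L hun)) (hv n) fun hvL => hvU (hLU hvL)
  exact hn.elim (disjoint_left.mp · (hu n) hun) (disjoint_left.mp · hsS hsL)

theorem tendsto_atEnd {K : CompactExhaustion C} (hS : EventuallySeparatesPoints S atTop)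
    (hconn : ∀ n, IsPreconnected (S n)) (hu : ∀ n, u n ∈ S n) (hv : ∀ n, v n ∈ S n)
    {e : SpaceEnd K}
    (he : Tendsto (fun n => EndCompactification.pt (u n)) atTop (𝓝 (.atEnd e))) :
    Tendsto (fun n => EndCompactification.pt (v n)) atTop (𝓝 (.atEnd e)) := by
  refine EndCompactification.tendsto_atEnd fun j => ?_
  have hcompact i : IsCompact (frontier (K i)) := (K.isCompact i).of_isClosed_subset
    isClosed_frontier (K.isCompact i).isClosed.frontier_subset
  have hdisj : Disjoint (frontier (K j)) (frontier (K (j + 1))) :=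
    disjoint_interior_frontier.mono_left
      ((K.isCompact j).isClosed.frontier_subset.trans (K.subset_interior_succ j))
  filter_upwards [hS.eventually_disjoint (hcompact j) (hcompact (j + 1)) hdisj,
    EndCompactification.eventually_mem_comp_of_tendsto_atEnd he j,
    EndCompactification.eventually_mem_comp_of_tendsto_atEnd he (j + 1)] with n hn huj huj'
  have hmeets {i} (hui : u n ∈ e.comp i) {b} (hb : b ∈ S n) (hbK : b ∈ K i) :
      ∃ s ∈ S n, s ∈ frontier (K i) :=
    exists_mem_frontier_of_isPreconnected (hconn n) hb hbK (hu n)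
      (EndCompactification.comp_subset_compl e i hui)
  refine EndCompactification.subset_comp_of_isPreconnected (hconn n) (hu n) huj
    (disjoint_left.mpr fun b hb hbK => ?_) (hv n)
  obtain ⟨s, hsS, hsK⟩ := hmeets huj hb hbK
  obtain ⟨t, htS, htK⟩ := hmeets huj' hb (K.subset_succ j hbK)
  exact hn.elim (disjoint_left.mp · hsS hsK) (disjoint_left.mp · htS htK)

theorem tendsto_pt {K : CompactExhaustion C} (hS : EventuallySeparatesPoints S atTop)
    (hconn : ∀ n, IsPreconnected (S n)) (hu : ∀ n, u n ∈ S n) (hv : ∀ n, v n ∈ S n)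
    {x : EndCompactification K}
    (hx : Tendsto (fun n => EndCompactification.pt (u n)) atTop (𝓝 x)) :
    Tendsto (fun n => EndCompactification.pt (v n)) atTop (𝓝 x) := by
  cases x with
  | pt y =>
    have := weaklyLocallyCompactSpace_of_compactExhaustion K
    have hpt := EndCompactification.isOpenEmbedding_pt (K := K)
    exact hpt.tendsto_nhds_iff.mp (hS.tendsto_nhds hconn hu hv (hpt.tendsto_nhds_iff.mpr hx))
  | atEnd e => exact hS.tendsto_atEnd hconn hu hv hx

end EventuallySeparatesPoints

/-! ### Divergence of the Kobayashi distance at the boundary -/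

section Domain

variable {E : Type*} [NormedAddCommGroup E] [NormedSpace ℂ E]
  {X : Type*} [TopologicalSpace X] {Ω : Opens X}

/-- The inclusion of `Ω` in its closure. -/
def toClosure (z : Ω) : closure (Ω : Set X) := ⟨z, subset_closure z.2⟩

theorem isOpenEmbedding_toClosure : IsOpenEmbedding (toClosure (Ω := Ω)) :=
  ⟨IsEmbedding.inclusion subset_closure, by
    convert! Ω.isOpen.preimage (continuous_subtype_val (p := (· ∈ closure (Ω : Set X))))
    exact range_inclusion subset_closure⟩

variable {K : CompactExhaustion (closure (Ω : Set X))}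

theorem isOpenEmbedding_toEnd : IsOpenEmbedding (toEnd K) :=
  EndCompactification.isOpenEmbedding_pt.comp isOpenEmbedding_toClosure

theorem locallyCompactSpace_of_compactExhaustion_closure [T2Space X]
    (K : CompactExhaustion (closure (Ω : Set X))) : LocallyCompactSpace Ω :=
  have := weaklyLocallyCompactSpace_of_compactExhaustion K
  isOpenEmbedding_toClosure.locallyCompactSpace

variable [ChartedSpace E X] [IsManifold 𝓘(ℂ, E) ω X] [ConnectedSpace Ω]

theorem mem_endBoundary_of_tendsto_toEnd {p : Ω} {u : ℕ → Ω}
    (hpu : Tendsto (fun n => kobayashiDist E p (u n)) atTop atTop) {x : EndCompactification K}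
    (hx : Tendsto (fun n => toEnd K (u n)) atTop (𝓝 x)) : x ∈ endBoundary K := by
  rintro ⟨z, rfl⟩
  have hu : Tendsto u atTop (𝓝 z) := isOpenEmbedding_toEnd.tendsto_nhds_iff.mpr hx
  exact not_tendsto_nhds_of_tendsto_atTop hpu _ (((continuous_kobayashiDist p).tendsto z).comp hu)

theorem eventually_notMem_image_kobayashiBall {p : Ω} {u : ℕ → Ω}
    (hpu : Tendsto (fun n => kobayashiDist E p (u n)) atTop atTop) (B : ℝ)
    (a : Ω) : ∀ᶠ q : ℕ × closure (Ω : Set X) in atTop ×ˢ 𝓝 (toClosure a),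
      q.2 ∉ toClosure '' {z : Ω | kobayashiDist E (u q.1) z < B} := by
  have hnear : ∀ᶠ s in 𝓝 (toClosure a),
      s ∈ toClosure '' {z | kobayashiDist E p z < kobayashiDist E p a + 1} :=
    isOpenEmbedding_toClosure.isOpenMap.image_mem_nhds
      ((continuous_kobayashiDist p).continuousAt.eventually_lt_const (lt_add_one _))
  filter_upwards [(hpu.eventually_ge_atTop (kobayashiDist E p a + 1 + B)).prod_mk hnear]
  rintro ⟨n, _⟩ ⟨hfar, z, hpz : kobayashiDist E p z < _, rfl⟩
    ⟨z', hz' : kobayashiDist E (u n) z' < B, hzz'⟩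
  obtain rfl := isOpenEmbedding_toClosure.injective hzz'
  have htri := kobayashiDist_triangle (E := E) p z' (u n)
  rw [kobayashiDist_comm z' (u n)] at htri
  linarith

theorem KobayashiDivergesAtBoundary.eventuallySeparatesPoints
    (hdiv : KobayashiDivergesAtBoundary E Ω) {p : Ω} {u : ℕ → Ω}
    (hpu : Tendsto (fun n => kobayashiDist E p (u n)) atTop atTop) (B : ℝ) :
    EventuallySeparatesPoints
      (fun n => toClosure '' {z : Ω | kobayashiDist E (u n) z < B}) atTop := by
  intro a b hab
  by_cases ha : a.1 ∈ Ω
  · exact ((tendsto_id.prodMap (continuous_fst.tendsto (a, b))).eventually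
      (eventually_notMem_image_kobayashiBall hpu B ⟨a, ha⟩)).mono fun q hq hS => hq hS.1
  by_cases hb : b.1 ∈ Ω
  · exact ((tendsto_id.prodMap (continuous_snd.tendsto (a, b))).eventually
      (eventually_notMem_image_kobayashiBall hpu B ⟨b, hb⟩)).mono fun q hq hS => hq hS.2
  have hfar := hdiv a (Ω.isOpen.frontier_eq ▸ ⟨a.2, ha⟩) b (Ω.isOpen.frontier_eq ▸ ⟨b.2, hb⟩)
    (Subtype.coe_ne_coe.mpr hab)
  have hcoe : Tendsto (fun q : ℕ × closure (Ω : Set X) × closure (Ω : Set X) =>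
      (q.2.1.1, q.2.2.1)) (atTop ×ˢ 𝓝 (a, b)) (𝓝 (a.1, b.1)) :=
    ((continuous_subtype_val.prodMap continuous_subtype_val).tendsto (a, b)).comp tendsto_snd
  filter_upwards [hcoe.eventually (eventually_comap.mp (hfar.eventually_ge_atTop (B + B)))]
  rintro ⟨n, _, _⟩ hle ⟨⟨z, hz : kobayashiDist E _ z < B, rfl⟩, w,
    hw : kobayashiDist E _ w < B, rfl⟩
  have htri := kobayashiDist_triangle (E := E) z (u n) w
  rw [kobayashiDist_comm z (u n)] at htri
  linarith [hle (z, w) rfl]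

theorem tendsto_toEnd_of_kobayashiDist_le [T2Space X] (hdiv : KobayashiDivergesAtBoundary E Ω)
    {p : Ω} {u v : ℕ → Ω} {B : ℝ} (huv : ∀ n, kobayashiDist E (u n) (v n) ≤ B)
    (hpu : Tendsto (fun n => kobayashiDist E p (u n)) atTop atTop)
    {x : EndCompactification K} (hx : Tendsto (fun n => toEnd K (u n)) atTop (𝓝 x)) :
    Tendsto (fun n => toEnd K (v n)) atTop (𝓝 x) := by
  have hvB n : kobayashiDist E (u n) (v n) < B + 1 := (huv n).trans_lt (lt_add_one B)
  have huB n : kobayashiDist E (u n) (u n) < B + 1 := by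
    rw [kobayashiDist_self]
    exact (kobayashiDist_nonneg (u n) (v n)).trans_lt (hvB n)
  exact (hdiv.eventuallySeparatesPoints hpu (B + 1)).tendsto_pt
    (fun n => (isPreconnected_kobayashiBall (u n) (B + 1)).image _
      isOpenEmbedding_toClosure.continuous.continuousOn)
    (fun n => mem_image_of_mem _ (huB n)) (fun n => mem_image_of_mem _ (hvB n)) hx

theorem tendsto_kobayashiDist_sub_horofunction {u : ℕ → Ω}
    {ξ : MetricCompactification.CStar (KobayashiSpace E Ω)}
    (hξ : Tendsto (fun n => MetricCompactification.emb (toKob E (u n))) atTop (𝓝 ξ)) (p z : Ω) :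
    Tendsto (fun n => ((kobayashiDist E z (u n) - kobayashiDist E p (u n) : ℝ) : EReal)) atTop
      (𝓝 (MetricCompactification.horofunction (toKob E p) ξ (toKob E z) : ℝ)) := by
  refine (continuous_coe_real_ereal.tendsto _).comp
    ((((MetricCompactification.continuous_horofunction (toKob E p) (toKob E z)).tendsto ξ).comp
      hξ).congr fun n => ?_)
  rw [kobayashiDist_comm z, kobayashiDist_comm p]
  rfl

theorem smallHorosphere_subset_kobayashiHoroball {p : Ω} {x : EndCompactification K}
    {ξ : MetricCompactification.CStar (KobayashiSpace E Ω)} (hξ : ξ ∈ metricFiber E K x) (R : ℝ) :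
    smallHorosphere E K p x R ⊆ kobayashiHoroball E p ξ R := by
  intro z hz
  obtain ⟨-, u, hux, huξ⟩ := hξ
  have hux' : Tendsto u atTop (comap (toEnd K) (𝓝 x)) := tendsto_comap_iff.mpr hux
  have hle := hux'.limsup_comp_le_limsup
    (u := fun w => ((kobayashiDist E z w - kobayashiDist E p w : ℝ) : EReal))
  exact EReal.coe_lt_coe_iff.mp
    (((tendsto_kobayashiDist_sub_horofunction huξ p z).limsup_eq.ge.trans hle).trans_lt hz)

theorem image_kobayashiHoroball_subset_bigHorosphere {g : Ω → Ω}
    (hg : ∀ z w, kobayashiDist E (g z) (g w) ≤ kobayashiDist E z w) {p : Ω} {u : ℕ → Ω}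
    (hpu : ∀ n, kobayashiDist E p (u n) ≤ kobayashiDist E p (g (u n)))
    {x : EndCompactification K} (hx : Tendsto (fun n => toEnd K (g (u n))) atTop (𝓝 x))
    {ξ : MetricCompactification.CStar (KobayashiSpace E Ω)}
    (hξ : Tendsto (fun n => MetricCompactification.emb (toKob E (u n))) atTop (𝓝 ξ)) (R : ℝ) :
    g '' kobayashiHoroball E p ξ R ⊆ bigHorosphere E K p x R := by
  rintro _ ⟨z, hz, rfl⟩
  have hx' : Tendsto (g ∘ u) atTop (comap (toEnd K) (𝓝 x)) := tendsto_comap_iff.mpr hx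
  set h := MetricCompactification.horofunction (toKob E p) ξ (toKob E z)
  have hhoro : (h : EReal) < ((1 / 2 * Real.log R : ℝ) : EReal) := EReal.coe_lt_coe_iff.mpr hz
  refine lt_of_le_of_lt ?_ hhoro
  calc liminf (fun w => ((kobayashiDist E (g z) w - kobayashiDist E p w : ℝ) : EReal))
        (comap (toEnd K) (𝓝 x))
    _ ≤ liminf (fun n => ((kobayashiDist E (g z) (g (u n)) - kobayashiDist E p (g (u n)) : ℝ) :
          EReal)) atTop := hx'.liminf_le_liminf_comp
    _ ≤ liminf (fun n => ((kobayashiDist E z (u n) - kobayashiDist E p (u n) : ℝ) : EReal))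
          atTop := liminf_le_liminf (.of_forall fun n =>
            EReal.coe_le_coe_iff.mpr (sub_le_sub (hg z (u n)) (hpu n)))
    _ = h := (tendsto_kobayashiDist_sub_horofunction hξ p z).liminf_eq

end Domain

theorem exists_strictMono_forall_le_add {a : ℕ → ℝ} (ha : Tendsto a atTop atTop) :
    ∃ m : ℕ → ℕ, StrictMono m ∧ ∀ k i, a (m k) ≤ a (m k + i) := by
  have hfreq : ∃ᶠ n in atTop, ∀ i, a n ≤ a (n + i) := by
    refine frequently_atTop.mpr fun N => ?_
    have hshift : Tendsto (fun i => a (N + i)) cofinite atTop := by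
      rw [Nat.cofinite_eq_atTop]
      exact ha.comp (tendsto_add_atTop_nat N |>.congr fun i => add_comm i N)
    obtain ⟨i₀, hi₀⟩ := hshift.exists_forall_le
    exact ⟨N + i₀, Nat.le_add_right N i₀, fun i => by
      rw [add_assoc]
      exact hi₀ (i₀ + i)⟩
  exact extraction_of_frequently_atTop hfreq

theorem theorem1p4_general {E : Type*} [NormedAddCommGroup E] [NormedSpace ℂ E]
    {X : Type*} [TopologicalSpace X] [T2Space X] [ChartedSpace E X] [IsManifold 𝓘(ℂ, E) ω X]
    (Ω : TopologicalSpace.Opens X) [ConnectedSpace Ω]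
    (K : CompactExhaustion (closure (Ω : Set X))) (hK : SeqCompactSpace (EndCompactification K))
    (hcomplete : IsCompleteKobayashiHyperbolic E Ω)
    (hdiv : KobayashiDivergesAtBoundary E Ω)
    (f : Ω → Ω) (hf : ∀ z w, kobayashiDist E (f z) (f w) ≤ kobayashiDist E z w)
    (hfdiv : CompactlyDivergent fun n => f^[n]) (p : Ω) :
    ∃ x ∈ endBoundary K, ∃ ξ ∈ metricFiber E K x,
      (∀ (n : ℕ) (R : ℝ), 0 < R →
        f^[n] '' kobayashiHoroball E p ξ R ⊆ bigHorosphere E K p x R) ∧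
      (∀ (n : ℕ) (R : ℝ), 0 < R →
        f^[n] '' smallHorosphere E K p x R ⊆ bigHorosphere E K p x R) := by
  have := locallyCompactSpace_of_compactExhaustion_closure K
  have := hcomplete.properSpace
  have horbit := hfdiv.tendsto_kobayashiDist hcomplete p
  obtain ⟨m, hm, hrecord⟩ := exists_strictMono_forall_le_add horbit
  obtain ⟨x, φ, hφ, hx⟩ := SeqCompactSpace.tendsto_subseq fun k => toEnd K (f^[m k] p)
  obtain ⟨ξ, hξ, ψ, hψ, hemb⟩ := MetricCompactification.exists_subseq_tendsto_emb_boundary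
    hasApproxIntermediatePoints_kobayashiSpace (p := toKob E p)
    (u := fun k => toKob E (f^[m (φ k)] p)) (horbit.comp (hm.comp hφ).tendsto_atTop)
  let u k := f^[m (φ (ψ k))] p
  have hpu : Tendsto (fun k => kobayashiDist E p (u k)) atTop atTop :=
    horbit.comp (hm.comp (hφ.comp hψ)).tendsto_atTop
  have hxu : Tendsto (fun k => toEnd K (u k)) atTop (𝓝 x) := hx.comp hψ.tendsto_atTop
  have hfiber : ξ ∈ metricFiber E K x := ⟨hξ, u, hxu, hemb⟩
  have hhoro n R : f^[n] '' kobayashiHoroball E p ξ R ⊆ bigHorosphere E K p x R := by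
    have hshift k : f^[n] (u k) = f^[m (φ (ψ k))] (f^[n] p) :=
      (Function.Commute.refl f).iterate_iterate n _ p
    have hnear k : kobayashiDist E (u k) (f^[n] (u k)) ≤ kobayashiDist E p (f^[n] p) :=
      (hshift k).symm ▸ kobayashiDist_iterate_le hf _ p (f^[n] p)
    refine image_kobayashiHoroball_subset_bigHorosphere (kobayashiDist_iterate_le hf n)
      (fun k => ?_) (tendsto_toEnd_of_kobayashiDist_le hdiv hnear hpu hxu) hemb R
    exact (hrecord _ n).trans_eq (by rw [hshift, Function.iterate_add_apply])
  exact ⟨x, mem_endBoundary_of_tendsto_toEnd hpu hxu, ξ, hfiber, fun n R _ => hhoro n R,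
    fun n R _ => (image_mono (smallHorosphere_subset_kobayashiHoroball hfiber R)).trans (hhoro n R)⟩

theorem theorem1p4 {E : Type*} [NormedAddCommGroup E] [NormedSpace ℂ E] [FiniteDimensional ℂ E]
    {X : Type*} [TopologicalSpace X] [T2Space X] [SecondCountableTopology X] [ChartedSpace E X]
    [IsManifold 𝓘(ℂ, E) ω X]
    (Ω : TopologicalSpace.Opens X) [ConnectedSpace Ω] (hΩ : (Ω : Set X) ≠ Set.univ)
    (K : CompactExhaustion (closure (Ω : Set X))) (hK : SeqCompactSpace (EndCompactification K))
    (hcomplete : IsCompleteKobayashiHyperbolic E Ω)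
    (hdiv : KobayashiDivergesAtBoundary E Ω)
    (f : Ω → Ω) (hf : MDifferentiable 𝓘(ℂ, E) 𝓘(ℂ, E) f)
    (hfdiv : CompactlyDivergent fun n => f^[n]) (p : Ω) :
    ∃ x ∈ endBoundary K, ∃ ξ ∈ metricFiber E K x,
      (∀ (n : ℕ) (R : ℝ), 0 < R →
        f^[n] '' kobayashiHoroball E p ξ R ⊆ bigHorosphere E K p x R) ∧
      (∀ (n : ℕ) (R : ℝ), 0 < R →
        f^[n] '' smallHorosphere E K p x R ⊆ bigHorosphere E K p x R) :=
  theorem1p4_general Ω K hK hcomplete hdiv f (kobayashiDist_map_le hf) hfdiv p
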